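/- Let $\alpha\in(0,2)$, $\sigma>0$, $H\in(0,1)$ and let $k\ge 1$ be an integer with $k<H+1/\alpha$. Let $(L_t)_{t\in\mathbb R}$ be a symmetric $\alpha$-stable Lévy process with scale parameter $\sigma$, i.e. $\mathbb E[e^{iuL_1}]=e^{-|\sigma u|^\alpha}$ for all $u\in\mathbb R$. Put $$\beta = 1+\alpha(k-H),\qquad h_k(x)=\sum_{j=0}^{k}(-1)^j\binom kj (x-j)_+^{H-1/\alpha},\qquad \|h_k\|_\alpha=\Big(\int_{\mathbb R}|h_k(x)|^\alpha\,dx\Big)^{1/\alpha},$$ where $x_+^a=0$ for $x\le 0$ and all $a\in\mathbb R$, and for $t\ge 0$, $x\in\mathbb R$, $n\in\mathbb N$ $$\Phi_t(x)=(\cos(tx)-1)\,e^{-|\sigma\|h_k\|_\alpha t|^\alpha},\qquad \overline\Phi_t(x)=\sum_{i=1}^\infty \Phi_t(h_k(i)x),$$ $$\overline S_n(t)=n^{-1/\beta}\sum_{i=k}^{n}\Big(\overline\Phi_t(L_{i+1}-L_i)-\mathbb E\big[\overline\Phi_t(L_{i+1}-L_i)\big]\Big)$$ (an empty sum is $0$).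 Then these quantities are well defined (that is, $\int_{\mathbb R}|h_k|^\alpha<\infty$, the series $\overline\Phi_t(x)$ converges absolutely, and $\overline\Phi_t(L_{i+1}-L_i)$ is integrable), and for every $r\in(0,\beta)$ $$\sup_{n\in\mathbb N,\;t\ge 0}\mathbb E\big[|\overline S_n(t)|^r\big]<\infty .$$ -/

import Mathlib

open MeasureTheory ProbabilityTheory Filter Topology
open scoped ENNReal

noncomputable section

namespace StableRegime

variable {Ω : Type*} [MeasurableSpace Ω]

/-- A two-sided real-valued Lévy process `(L_t)_{t ∈ ℝ}`: it starts at `0`, has independent and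
stationary increments, and almost all of its paths are càdlàg. -/
structure IsLevyProcess (L : ℝ → Ω → ℝ) (P : Measure Ω) : Prop where
  measurable : ∀ t, Measurable (L t)
  zero : ∀ᵐ ω ∂P, L 0 ω = 0
  indep_increments : HasIndepIncrements L P
  stationary_increments : ∀ s t : ℝ, s ≤ t →
    IdentDistrib (fun ω ↦ L t ω - L s ω) (fun ω ↦ L (t - s) ω - L 0 ω) P P
  cadlag : ∀ᵐ ω ∂P, ∀ t : ℝ, ContinuousWithinAt (fun s ↦ L s ω) (Set.Ici t) t ∧
    ∃ l : ℝ, Tendsto (fun s ↦ L s ω) (𝓝[<] t) (𝓝 l)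

/-- A symmetric `α`-stable Lévy process with scale parameter `σ`: a Lévy process such that
`E[exp(i u L_1)] = exp(-|σ u|^α)` for all real `u`. -/
structure IsSymmetricStableLevyProcess (α σ : ℝ) (L : ℝ → Ω → ℝ) (P : Measure Ω) : Prop where
  isLevyProcess : IsLevyProcess L P
  charFun_one : ∀ u : ℝ, charFun (P.map (L 1)) u = Complex.exp (-((|σ * u| ^ α : ℝ) : ℂ))

/-- `x_+^a`, with the convention `x_+^a = 0` for all `x ≤ 0` and all real `a` (also `a ≤ 0`). -/
def posPow (a x : ℝ) : ℝ := if 0 < x then x ^ a else 0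

/-- The `k`-th order increment of the kernel of linear fractional stable motion,
`h_k(x) = ∑_{j=0}^k (-1)^j (k choose j) (x - j)_+^{H - 1/α}`. -/
def hKernel (α H : ℝ) (k : ℕ) (x : ℝ) : ℝ :=
  ∑ j ∈ Finset.range (k + 1), (-1 : ℝ) ^ j * (k.choose j : ℝ) * posPow (H - 1 / α) (x - j)

/-- `‖h_k‖_α = (∫ |h_k(x)|^α dx)^{1/α}`. -/
def hNorm (α H : ℝ) (k : ℕ) : ℝ := (∫ x : ℝ, |hKernel α H k x| ^ α) ^ (1 / α)

/-- `β = 1 + α (k - H)`. -/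
def betaIndex (α H : ℝ) (k : ℕ) : ℝ := 1 + α * (k - H)

/-- `Φ_t(x) = (cos(t x) - 1) exp(-|σ ‖h_k‖_α t|^α)`. -/
def Phi (σ α H : ℝ) (k : ℕ) (t x : ℝ) : ℝ :=
  (Real.cos (t * x) - 1) * Real.exp (-|σ * hNorm α H k * t| ^ α)

/-- `Φ̄_t(x) = ∑_{i=1}^∞ Φ_t(h_k(i) x)`. -/
def PhiBar (σ α H : ℝ) (k : ℕ) (t x : ℝ) : ℝ :=
  ∑' i : ℕ, Phi σ α H k t (hKernel α H k ((i : ℝ) + 1) * x)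

/-- `S̄_n(t) = n^{-1/β} ∑_{i=k}^n (Φ̄_t(L_{i+1} - L_i) - E[Φ̄_t(L_{i+1} - L_i)])`. -/
def SBar (σ α H : ℝ) (k : ℕ) (L : ℝ → Ω → ℝ) (P : Measure Ω) (n : ℕ) (t : ℝ) (ω : Ω) : ℝ :=
  (n : ℝ) ^ (-1 / betaIndex α H k) *
    ∑ i ∈ Finset.Icc k n, (PhiBar σ α H k t (L ((i : ℝ) + 1) ω - L (i : ℝ) ω)
      - ∫ ω', PhiBar σ α H k t (L ((i : ℝ) + 1) ω' - L (i : ℝ) ω') ∂P)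

end StableRegime

end

namespace StableRegime

/-! Put `γ = k + 1/α - H`, so that `β = αγ`. The kernel satisfies `h_k(i) = O(i^(-γ))`, being a
`k`-th difference of a power, and `|cos w - 1| ≤ min(2, w²/2)`. In the series `Φ̄_t(x)` about
`(t|x|)^(1/γ)` terms have an argument of order one. The rest sum to the same order because `2γ > 1`.
The factor `t^(1/γ)` is absorbed by the exponential, since `1/γ ≤ α`. Hence `|Φ̄_t(x)| ≤ K
|x|^(1/γ)` uniformly in `t` (`exists_PhiBar_bound`).

An increment of `L` over unit time has tails `O(y^(-α))`, so `Φ̄_t` of it has tails `O(y^(-β))`,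
uniformly in `t`. Here `1 < β < 2`, from `H < k < H + 1/α`: means exist, and truncated second
moments are governed by the truncation level. For independent summands, truncation and Chebyshev's
inequality give a tail `M n v^(-β)` for the centred sum of `n` terms
(`measureReal_abs_sum_sub_integral_gt_le`). Taking `v = y n^(1/β)` cancels `n`, and a uniform tail
of order `β` bounds every moment of order `r < β`. -/

lemma lintegral_Ioc_rpow {p u : ℝ} (hp : -1 < p) (hu : 0 < u) :
    ∫⁻ t in Set.Ioc 0 u, ENNReal.ofReal (t ^ p) = ENNReal.ofReal (u ^ (p + 1) / (p + 1)) := by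
  have hint : IntegrableOn (fun t : ℝ ↦ t ^ p) (Set.Ioc 0 u) :=
    (intervalIntegrable_iff_integrableOn_Ioc_of_le hu.le).1
      (intervalIntegral.intervalIntegrable_rpow' hp)
  rw [← ofReal_integral_eq_lintegral_ofReal hint, ← intervalIntegral.integral_of_le hu.le,
    integral_rpow (Or.inl hp), Real.zero_rpow (by linarith), sub_zero]
  filter_upwards [ae_restrict_mem measurableSet_Ioc] with t ht
  exact Real.rpow_nonneg ht.1.le _

lemma lintegral_Ioi_rpow {p u : ℝ} (hp : p < -1) (hu : 0 < u) :
    ∫⁻ t in Set.Ioi u, ENNReal.ofReal (t ^ p) = ENNReal.ofReal (-u ^ (p + 1) / (p + 1)) := by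
  rw [← ofReal_integral_eq_lintegral_ofReal (integrableOn_Ioi_rpow_of_lt hp hu),
    integral_Ioi_rpow_of_lt hp hu]
  filter_upwards [ae_restrict_mem measurableSet_Ioi] with t ht
  exact Real.rpow_nonneg (hu.trans ht).le _

/-! ### Moments from power tails -/

section Tails

variable {Ω : Type*} [MeasurableSpace Ω] {μ : Measure Ω}

/-- The `p`-th moment of the large values of a variable with power tails. -/
lemma lintegral_indicator_gt_rpow_le [IsFiniteMeasure μ] {Y : Ω → ℝ} (hY : Measurable Y)
    {C b p u : ℝ} (hC : 0 ≤ C) (hp : 0 < p) (hpb : p < b) (hu : 0 < u)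
    (htail : ∀ y, 0 < y → μ.real {ω | y < |Y ω|} ≤ C * y ^ (-b)) :
    ∫⁻ ω, ENNReal.ofReal ({ω | u < |Y ω|}.indicator (fun ω ↦ |Y ω|) ω ^ p) ∂μ
      ≤ ENNReal.ofReal (C * b / (b - p) * u ^ (p - b)) := by
  have hms : MeasurableSet {ω | u < |Y ω|} := measurableSet_lt measurable_const (by fun_prop)
  have hpb' : 0 < b - p := by linarith
  have htail' : ∀ y, 0 < y → μ {ω | y < |Y ω|} ≤ ENNReal.ofReal (C * y ^ (-b)) := fun y hy ↦
    (ENNReal.le_ofReal_iff_toReal_le (measure_ne_top _ _)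
      (mul_nonneg hC (Real.rpow_nonneg hy.le _))).2 (htail y hy)
  rw [lintegral_rpow_eq_lintegral_meas_lt_mul μ
    (ae_of_all _ fun ω ↦ Set.indicator_nonneg (fun ω _ ↦ abs_nonneg _) ω)
    ((hY.abs.indicator hms).aemeasurable) hp, ← Set.Ioc_union_Ioi_eq_Ioi hu.le,
    lintegral_union measurableSet_Ioi Set.Ioc_disjoint_Ioi_same]
  -- The alternative `t < 0` covers the points where the indicator vanishes; it is void at the
  -- positive levels integrated below.
  have hsub : ∀ t, μ {ω | t < {ω | u < |Y ω|}.indicator (fun ω ↦ |Y ω|) ω} ≤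
      μ {ω | t < 0 ∨ (t < |Y ω| ∧ u < |Y ω|)} := fun t ↦ by
    refine measure_mono fun ω hω ↦ ?_
    simp only [Set.mem_ofPred_eq, Set.indicator_apply] at hω ⊢
    split_ifs at hω with h
    · exact Or.inr ⟨hω, h⟩
    · exact Or.inl hω
  -- In the layer-cake integral, levels below `u` only see the event `u < |Y|`; levels above `u` see
  -- the tail itself.
  have h1 : ∫⁻ t in Set.Ioc 0 u, μ {ω | t < {ω | u < |Y ω|}.indicator (fun ω ↦ |Y ω|) ω} *
      ENNReal.ofReal (t ^ (p - 1)) ≤ ENNReal.ofReal (C * u ^ (-b)) *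
        ENNReal.ofReal (u ^ p / p) := by
    calc _ ≤ ∫⁻ t in Set.Ioc 0 u, ENNReal.ofReal (C * u ^ (-b)) *
          ENNReal.ofReal (t ^ (p - 1)) := by
          refine setLIntegral_mono (by fun_prop) fun t ht ↦ ?_
          gcongr
          refine (hsub t).trans ((measure_mono ?_).trans (htail' u hu))
          rintro ω (h | h)
          · exact absurd h (not_lt.2 ht.1.le)
          · exact h.2
      _ = _ := by
          rw [lintegral_const_mul _ (by fun_prop), lintegral_Ioc_rpow (by linarith) hu,
            sub_add_cancel]
  have h2 : ∫⁻ t in Set.Ioi u, μ {ω | t < {ω | u < |Y ω|}.indicator (fun ω ↦ |Y ω|) ω} *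
      ENNReal.ofReal (t ^ (p - 1)) ≤ ENNReal.ofReal C *
        ENNReal.ofReal (u ^ (p - b) / (b - p)) := by
    calc _ ≤ ∫⁻ t in Set.Ioi u, ENNReal.ofReal C * ENNReal.ofReal (t ^ (p - 1 - b)) := by
          refine setLIntegral_mono (by fun_prop) fun t ht ↦ ?_
          have ht0 : 0 < t := hu.trans ht
          rw [sub_eq_add_neg (p - 1) b, add_comm, Real.rpow_add ht0,
            ENNReal.ofReal_mul (Real.rpow_nonneg ht0.le _), ← mul_assoc, ← ENNReal.ofReal_mul hC]
          gcongr
          refine (hsub t).trans ((measure_mono ?_).trans (htail' t ht0))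
          rintro ω (h | h)
          · exact absurd h (not_lt.2 ht0.le)
          · exact h.1
      _ = _ := by
          rw [lintegral_const_mul _ (by fun_prop), lintegral_Ioi_rpow (by linarith) hu,
            show p - 1 - b + 1 = -(b - p) by ring, neg_div_neg_eq, neg_sub]
  calc _ ≤ ENNReal.ofReal p * (ENNReal.ofReal (C * u ^ (-b)) * ENNReal.ofReal (u ^ p / p) +
        ENNReal.ofReal C * ENNReal.ofReal (u ^ (p - b) / (b - p))) := by gcongr
    _ = _ := by
      have e : u ^ (-b) * u ^ p = u ^ (p - b) := by rw [← Real.rpow_add hu]; congr 1; ring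
      rw [← ENNReal.ofReal_mul (by positivity), ← ENNReal.ofReal_mul hC,
        ← ENNReal.ofReal_add (by positivity) (by positivity), ← ENNReal.ofReal_mul hp.le]
      congr 1
      rw [show C * u ^ (-b) * (u ^ p / p) = C * (u ^ (-b) * u ^ p) / p by ring, e]
      field_simp
      ring

/-- The `p`-th moment of the small values of a variable with power tails. -/
lemma lintegral_indicator_le_rpow_le [IsFiniteMeasure μ] {Y : Ω → ℝ} (hY : Measurable Y)
    {C b p u : ℝ} (hC : 0 ≤ C) (hp : 0 < p) (hpb : b < p) (hu : 0 < u)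
    (htail : ∀ y, 0 < y → μ.real {ω | y < |Y ω|} ≤ C * y ^ (-b)) :
    ∫⁻ ω, ENNReal.ofReal ({ω | |Y ω| ≤ u}.indicator (fun ω ↦ |Y ω|) ω ^ p) ∂μ
      ≤ ENNReal.ofReal (C * p / (p - b) * u ^ (p - b)) := by
  have hms : MeasurableSet {ω | |Y ω| ≤ u} := measurableSet_le (by fun_prop) measurable_const
  have hpb' : 0 < p - b := by linarith
  rw [lintegral_rpow_eq_lintegral_meas_lt_mul μ
    (ae_of_all _ fun ω ↦ Set.indicator_nonneg (fun ω _ ↦ abs_nonneg _) ω)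
    ((hY.abs.indicator hms).aemeasurable) hp, ← Set.Ioc_union_Ioi_eq_Ioi hu.le,
    lintegral_union measurableSet_Ioi Set.Ioc_disjoint_Ioi_same]
  have h1 : ∫⁻ t in Set.Ioc 0 u, μ {ω | t < {ω | |Y ω| ≤ u}.indicator (fun ω ↦ |Y ω|) ω} *
      ENNReal.ofReal (t ^ (p - 1)) ≤ ENNReal.ofReal C *
        ENNReal.ofReal (u ^ (p - b) / (p - b)) := by
    calc _ ≤ ∫⁻ t in Set.Ioc 0 u, ENNReal.ofReal C * ENNReal.ofReal (t ^ (p - 1 - b)) := by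
          refine setLIntegral_mono (by fun_prop) fun t ht ↦ ?_
          have ht0 : 0 < t := ht.1
          rw [sub_eq_add_neg (p - 1) b, add_comm, Real.rpow_add ht0,
            ENNReal.ofReal_mul (Real.rpow_nonneg ht0.le _), ← mul_assoc, ← ENNReal.ofReal_mul hC]
          gcongr
          refine (measure_mono fun ω hω ↦ ?_).trans ((ENNReal.le_ofReal_iff_toReal_le
            (measure_ne_top _ _) (mul_nonneg hC (Real.rpow_nonneg ht0.le _))).2 (htail t ht0))
          simp only [Set.mem_ofPred_eq, Set.indicator_apply] at hω ⊢
          split_ifs at hω with h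
          · exact hω
          · exact absurd hω (not_lt.2 ht0.le)
      _ = _ := by
          rw [lintegral_const_mul _ (by fun_prop), lintegral_Ioc_rpow (by linarith) hu,
            show p - 1 - b + 1 = p - b by ring]
  have h2 : ∫⁻ t in Set.Ioi u, μ {ω | t < {ω | |Y ω| ≤ u}.indicator (fun ω ↦ |Y ω|) ω} *
      ENNReal.ofReal (t ^ (p - 1)) = 0 := by
    rw [← nonpos_iff_eq_zero, ← lintegral_zero (μ := volume.restrict (Set.Ioi u))]
    refine setLIntegral_mono (by fun_prop) fun t ht ↦ ?_
    have : {ω | t < {ω | |Y ω| ≤ u}.indicator (fun ω ↦ |Y ω|) ω} = ∅ := by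
      ext ω
      have ht' : u < t := ht
      simp only [Set.mem_ofPred_eq, Set.indicator_apply, Set.mem_empty_iff_false, iff_false, not_lt]
      split_ifs with h <;> linarith
    simp [this]
  rw [h2, add_zero]
  calc _ ≤ ENNReal.ofReal p * (ENNReal.ofReal C * ENNReal.ofReal (u ^ (p - b) / (p - b))) := by
        gcongr
    _ = _ := by
      rw [← ENNReal.ofReal_mul hC, ← ENNReal.ofReal_mul hp.le]
      congr 1
      ring

/-- Power tails of order `b` give uniformly bounded moments of order `r < b`. -/
lemma lintegral_abs_rpow_le_of_tail [IsProbabilityMeasure μ] {Y : Ω → ℝ} (hY : Measurable Y)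
    {C b r : ℝ} (hC : 0 ≤ C) (hr : 0 < r) (hrb : r < b)
    (htail : ∀ y, 0 < y → μ.real {ω | y < |Y ω|} ≤ C * y ^ (-b)) :
    ∫⁻ ω, ENNReal.ofReal (|Y ω| ^ r) ∂μ ≤ 1 + ENNReal.ofReal (C * b / (b - r)) := by
  have h := lintegral_indicator_gt_rpow_le hY hC hr hrb one_pos htail
  rw [Real.one_rpow, mul_one] at h
  calc ∫⁻ ω, ENNReal.ofReal (|Y ω| ^ r) ∂μ
      ≤ ∫⁻ ω, (1 + ENNReal.ofReal ({ω | 1 < |Y ω|}.indicator (fun ω ↦ |Y ω|) ω ^ r)) ∂μ := by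
        refine lintegral_mono fun ω ↦ ?_
        by_cases h1 : 1 < |Y ω|
        · rw [Set.indicator_of_mem (by exact h1)]
          exact le_add_self
        · refine le_trans ?_ le_self_add
          exact ENNReal.ofReal_le_one.2 (Real.rpow_le_one (abs_nonneg _) (not_lt.1 h1) hr.le)
    _ ≤ _ := by
        rw [lintegral_add_left measurable_const, lintegral_const, measure_univ, mul_one]
        gcongr

lemma integrable_of_tail [IsProbabilityMeasure μ] {Y : Ω → ℝ} (hY : Measurable Y)
    {C b : ℝ} (hC : 0 ≤ C) (hb : 1 < b)
    (htail : ∀ y, 0 < y → μ.real {ω | y < |Y ω|} ≤ C * y ^ (-b)) : Integrable Y μ := by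
  refine ⟨hY.aestronglyMeasurable, ?_⟩
  rw [hasFiniteIntegral_iff_norm]
  have h := lintegral_abs_rpow_le_of_tail hY hC one_pos hb htail
  simp only [Real.rpow_one] at h
  exact h.trans_lt (by simp)

end Tails

/-! ### Tails of centred sums of independent variables -/

section Sums

variable {Ω : Type*} [MeasurableSpace Ω] {μ : Measure Ω} [IsProbabilityMeasure μ]

/-- Truncation of a real number at level `v`. -/
noncomputable def cutoff (v x : ℝ) : ℝ := if |x| ≤ v then x else 0

lemma measurable_cutoff (v : ℝ) : Measurable (cutoff v) :=
  Measurable.ite (measurableSet_le (by fun_prop) measurable_const) measurable_id measurable_const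

lemma abs_cutoff_le {v : ℝ} (hv : 0 ≤ v) (x : ℝ) : |cutoff v x| ≤ v := by
  unfold cutoff
  split_ifs with h
  · exact h
  · simpa using hv

lemma memLp_cutoff {Z : Ω → ℝ} (hZ : Measurable Z) {v : ℝ} (hv : 0 ≤ v) (p : ℝ≥0∞) :
    MemLp (fun ω ↦ cutoff v (Z ω)) p μ :=
  MemLp.of_bound ((measurable_cutoff v).comp hZ).aestronglyMeasurable v
    (ae_of_all _ fun _ ↦ abs_cutoff_le hv _)

/-- The truncation error lives on `v < |Z|`, where the first moment is controlled because `b > 1`.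
-/
lemma abs_integral_sub_integral_cutoff_le {Z : Ω → ℝ} (hZ : Measurable Z) {C b v : ℝ}
    (hC : 0 ≤ C) (hb : 1 < b) (hv : 0 < v)
    (htail : ∀ y, 0 < y → μ.real {ω | y < |Z ω|} ≤ C * y ^ (-b)) :
    |∫ ω, Z ω ∂μ - ∫ ω, cutoff v (Z ω) ∂μ| ≤ C * b / (b - 1) * v ^ (1 - b) := by
  have hb' : 0 < b - 1 := by linarith
  have hm : Measurable fun ω ↦ ‖Z ω - cutoff v (Z ω)‖ :=
    (hZ.sub ((measurable_cutoff v).comp hZ)).norm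
  rw [← integral_sub (integrable_of_tail hZ hC hb htail)
    ((memLp_cutoff hZ hv.le 1).integrable le_rfl)]
  rw [← Real.norm_eq_abs]
  refine (norm_integral_le_integral_norm _).trans ?_
  rw [integral_eq_lintegral_of_nonneg_ae (ae_of_all _ fun _ ↦ norm_nonneg _)
    hm.aestronglyMeasurable]
  refine ENNReal.toReal_le_of_le_ofReal (by positivity) ?_
  refine le_trans (lintegral_mono fun ω ↦ ?_)
    (lintegral_indicator_gt_rpow_le hZ hC one_pos hb hv htail)
  rw [Real.rpow_one]
  refine ENNReal.ofReal_le_ofReal ?_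
  simp only [cutoff, Set.indicator_apply, Set.mem_ofPred_eq, Real.norm_eq_abs, ← not_le]
  split_ifs <;> simp

/-- The variance is at most the second moment of the small values, which the tail controls because
`b < 2`. -/
lemma variance_cutoff_le {Z : Ω → ℝ} (hZ : Measurable Z) {C b v : ℝ}
    (hC : 0 ≤ C) (hb : b < 2) (hv : 0 < v)
    (htail : ∀ y, 0 < y → μ.real {ω | y < |Z ω|} ≤ C * y ^ (-b)) :
    variance (fun ω ↦ cutoff v (Z ω)) μ ≤ C * 2 / (2 - b) * v ^ (2 - b) := by
  have hb' : 0 < 2 - b := by linarith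
  have hm : Measurable fun ω ↦ cutoff v (Z ω) := (measurable_cutoff v).comp hZ
  refine (variance_le_expectation_sq hm.aestronglyMeasurable).trans ?_
  simp only [Pi.pow_apply]
  rw [integral_eq_lintegral_of_nonneg_ae (ae_of_all _ fun _ ↦ sq_nonneg _)
    (hm.pow_const 2).aestronglyMeasurable]
  refine ENNReal.toReal_le_of_le_ofReal (by positivity) ?_
  refine le_trans (lintegral_mono fun ω ↦ ?_)
    (lintegral_indicator_le_rpow_le hZ hC two_pos hb hv htail)
  refine ENNReal.ofReal_le_ofReal ?_
  simp only [cutoff, Set.indicator_apply, Set.mem_ofPred_eq]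
  split_ifs <;> simp

/-- Centred sums of independent variables with uniform power tails of order `b ∈ (1, 2)` have
power tails of the same order, with a constant proportional to the number of summands. -/
theorem measureReal_abs_sum_sub_integral_gt_le {ι : Type*} {Z : ι → Ω → ℝ}
    (hZ : ∀ i, Measurable (Z i)) (hind : iIndepFun Z μ) {C b : ℝ} (hC : 0 ≤ C)
    (hb : 1 < b) (hb2 : b < 2)
    (htail : ∀ i y, 0 < y → μ.real {ω | y < |Z i ω|} ≤ C * y ^ (-b))
    (s : Finset ι) {v : ℝ} (hv : 0 < v) :
    μ.real {ω | v < |∑ i ∈ s, (Z i ω - ∫ ω', Z i ω' ∂μ)|} ≤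
      (C + 2 * (C * b / (b - 1)) + 4 * (C * 2 / (2 - b))) * s.card * v ^ (-b) := by
  have hb' : 0 < b - 1 := by linarith
  have hb2' : 0 < 2 - b := by linarith
  set C₁ := C * b / (b - 1) with hC₁
  set C₂ := C * 2 / (2 - b) with hC₂
  have hC₁0 : 0 ≤ C₁ := by positivity
  have hC₂0 : 0 ≤ C₂ := by positivity
  have hvb : 0 < v ^ (-b) := Real.rpow_pos_of_pos hv _
  have hcard : (0 : ℝ) ≤ s.card := by positivity
  -- If this quantity is at least one, the claimed bound exceeds one and is trivial. Otherwise the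
  -- total bias from truncating at `v` is at most `v / 2`.
  by_cases hbig : 1 ≤ 2 * C₁ * s.card * v ^ (-b)
  · refine measureReal_le_one.trans (hbig.trans ?_)
    gcongr
    linarith
  push Not at hbig
  set W : ι → Ω → ℝ := fun i ω ↦ cutoff v (Z i ω) with hW
  have hWL : ∀ i, MemLp (W i) 2 μ := fun i ↦ memLp_cutoff (hZ i) hv.le 2
  have hWI : ∀ i, Integrable (W i) μ := fun i ↦ (hWL i).integrable one_le_two
  have hvar : variance (∑ i ∈ s, W i) μ ≤ s.card * (C₂ * v ^ (2 - b)) := by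
    rw [IndepFun.variance_sum (fun i _ ↦ hWL i) fun i _ j _ hij ↦
      (hind.indepFun hij).comp (measurable_cutoff v) (measurable_cutoff v), ← nsmul_eq_mul]
    exact Finset.sum_le_card_nsmul _ _ _ fun i _ ↦
      variance_cutoff_le (hZ i) hC hb2 hv (htail i)
  have hcheb : μ.real {ω | v / 2 ≤ |(∑ i ∈ s, W i) ω - ∫ ω', (∑ i ∈ s, W i) ω' ∂μ|} ≤
      4 * C₂ * s.card * v ^ (-b) := by
    refine (ENNReal.toReal_le_of_le_ofReal
      (div_nonneg (variance_nonneg _ _) (sq_nonneg _))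
      (meas_ge_le_variance_div_sq (memLp_finsetSum' s fun i _ ↦ hWL i) (half_pos hv))).trans ?_
    rw [div_le_iff₀ (by positivity)]
    refine hvar.trans (le_of_eq ?_)
    rw [show (2 : ℝ) - b = -b + 2 by ring, Real.rpow_add hv, Real.rpow_two]
    ring
  have hunion : μ.real (⋃ i ∈ s, {ω | v < |Z i ω|}) ≤ C * s.card * v ^ (-b) := by
    refine (measureReal_biUnion_finset_le s _).trans ?_
    refine (Finset.sum_le_card_nsmul _ _ _ fun i _ ↦ htail i v hv).trans (le_of_eq ?_)
    rw [nsmul_eq_mul]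
    ring
  have hmean : |∑ i ∈ s, ∫ ω', Z i ω' ∂μ - ∫ ω', (∑ i ∈ s, W i) ω' ∂μ| ≤ v / 2 := by
    have h1 : ∫ ω', (∑ i ∈ s, W i) ω' ∂μ = ∑ i ∈ s, ∫ ω', W i ω' ∂μ := by
      simp only [Finset.sum_apply]
      exact integral_finsetSum s fun i _ ↦ hWI i
    rw [h1, ← Finset.sum_sub_distrib]
    refine (Finset.abs_sum_le_sum_abs _ _).trans ((Finset.sum_le_card_nsmul _ _ _ fun i _ ↦
      abs_integral_sub_integral_cutoff_le (hZ i) hC hb hv (htail i)).trans ?_)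
    rw [nsmul_eq_mul, ← hC₁, show (1 : ℝ) - b = -b + 1 by ring, Real.rpow_add hv, Real.rpow_one]
    nlinarith
  -- If no summand exceeds `v`, truncation changes nothing, and a deviation above `v` less a bias of
  -- at most `v / 2` leaves at least `v / 2`.
  have hincl : {ω | v < |∑ i ∈ s, (Z i ω - ∫ ω', Z i ω' ∂μ)|} ⊆
      (⋃ i ∈ s, {ω | v < |Z i ω|}) ∪
        {ω | v / 2 ≤ |(∑ i ∈ s, W i) ω - ∫ ω', (∑ i ∈ s, W i) ω' ∂μ|} := by
    intro ω hω
    by_contra hcon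
    simp only [Set.mem_union, Set.mem_iUnion, Set.mem_ofPred_eq, not_or, not_exists, not_lt,
      not_le] at hcon hω
    obtain ⟨hsmall, hdev⟩ := hcon
    have hWZ : (∑ i ∈ s, W i) ω = ∑ i ∈ s, Z i ω := by
      rw [Finset.sum_apply]
      exact Finset.sum_congr rfl fun i hi ↦ if_pos (hsmall i hi)
    rw [hWZ] at hdev
    rw [Finset.sum_sub_distrib] at hω
    rw [abs_le] at hmean
    rw [abs_lt] at hdev
    rw [lt_abs] at hω
    rcases hω with h | h <;> linarith [hmean.1, hmean.2, hdev.1, hdev.2]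
  calc _ ≤ C * s.card * v ^ (-b) + 4 * C₂ * s.card * v ^ (-b) :=
        (measureReal_mono hincl).trans ((measureReal_union_le _ _).trans (add_le_add hunion hcheb))
    _ ≤ _ := by
        have : 0 ≤ 2 * C₁ * s.card * v ^ (-b) := by positivity
        linarith

end Sums

/-! ### Decay and integrability of the kernel -/

section Kernel

/-- Differentiation commutes with differencing, which lets an induction on `k` trade one difference
for one power. -/
lemma hasDerivAt_fwdDiff_iter_rpow (k : ℕ) (a : ℝ) {y : ℝ} (hy : 0 < y) :
    HasDerivAt ((fwdDiff (1 : ℝ))^[k] fun x : ℝ ↦ x ^ a)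
      (a * (fwdDiff (1 : ℝ))^[k] (fun x : ℝ ↦ x ^ (a - 1)) y) y := by
  induction k generalizing y with
  | zero => simpa using Real.hasDerivAt_rpow_const (p := a) (Or.inl hy.ne')
  | succ k ih =>
    simp only [Function.iterate_succ_apply']
    have h1 := (ih (y := y + 1) (by linarith)).comp_add_const y 1
    have h := h1.sub (ih hy)
    rw [← mul_sub] at h
    exact h

/-- The `k`-th forward difference of `x ↦ x ^ a` is of order `y ^ (a - k)`. -/
lemma exists_abs_fwdDiff_iter_rpow_le (k : ℕ) (a : ℝ) (ha : a ≤ k) :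
    ∃ C, 0 ≤ C ∧ ∀ y : ℝ, 0 < y →
      |(fwdDiff (1 : ℝ))^[k] (fun x : ℝ ↦ x ^ a) y| ≤ C * y ^ (a - k) := by
  induction k generalizing a with
  | zero =>
    refine ⟨1, zero_le_one, fun y hy ↦ ?_⟩
    simp [abs_of_nonneg (Real.rpow_nonneg hy.le a)]
  | succ k ih =>
    push_cast at ha
    obtain ⟨C, hC, h⟩ := ih (a - 1) (by linarith)
    refine ⟨|a| * C, by positivity, fun y hy ↦ ?_⟩
    rw [Function.iterate_succ_apply', fwdDiff]
    -- Mean value inequality on `[y, y + 1]`; as `a - 1 - k ≤ 0`, the derivative bound is largest at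
    -- the left end.
    have hmv := Convex.norm_image_sub_le_of_norm_hasDerivWithin_le (𝕜 := ℝ)
      (f := (fwdDiff (1 : ℝ))^[k] fun x : ℝ ↦ x ^ a) (s := Set.Icc y (y + 1))
      (C := |a| * (C * y ^ (a - 1 - k)))
      (fun x hx ↦ (hasDerivAt_fwdDiff_iter_rpow k a (hy.trans_le hx.1)).hasDerivWithinAt)
      (fun x hx ↦ by
        rw [norm_mul, Real.norm_eq_abs, Real.norm_eq_abs]
        refine mul_le_mul_of_nonneg_left ((h x (hy.trans_le hx.1)).trans ?_) (abs_nonneg a)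
        exact mul_le_mul_of_nonneg_left (Real.rpow_le_rpow_of_nonpos hy hx.1 (by linarith)) hC)
      (convex_Icc _ _) (Set.left_mem_Icc.2 (by linarith)) (Set.right_mem_Icc.2 (by linarith))
    rw [add_sub_cancel_left, norm_one, mul_one, Real.norm_eq_abs] at hmv
    refine hmv.trans (le_of_eq ?_)
    push_cast
    rw [show a - 1 - (k : ℝ) = a - (k + 1) by ring]
    ring

/-- Beyond `k` every positive part is a genuine power, and reversing the sum turns backward
differences at `x` into forward differences at `x - k`. -/
lemma hKernel_eq_fwdDiff_iter (α H : ℝ) (k : ℕ) {x : ℝ} (hx : (k : ℝ) < x) :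
    hKernel α H k x = (fwdDiff (1 : ℝ))^[k] (fun x : ℝ ↦ x ^ (H - 1 / α)) (x - k) := by
  rw [fwdDiff_iter_eq_sum_shift, hKernel, ← Finset.sum_range_reflect]
  refine Finset.sum_congr rfl fun j hj ↦ ?_
  have hjk : j ≤ k := Nat.lt_succ_iff.1 (Finset.mem_range.1 hj)
  rw [show k + 1 - 1 - j = k - j by omega, Nat.choose_symm hjk, Nat.cast_sub hjk, posPow,
    if_pos (by have : (0 : ℝ) ≤ j := j.cast_nonneg; linarith)]
  simp only [zsmul_eq_mul, nsmul_eq_mul, mul_one]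
  push_cast
  congr 2
  ring

lemma exists_abs_hKernel_le_sub_rpow {α H : ℝ} {k : ℕ} (hα : 0 < α) (hH : H < 1) (hk : 1 ≤ k) :
    ∃ C, 0 ≤ C ∧ ∀ x : ℝ, (k : ℝ) < x → |hKernel α H k x| ≤ C * (x - k) ^ (H - 1 / α - k) := by
  have hk' : (1 : ℝ) ≤ k := by exact_mod_cast hk
  have hα' : 0 < 1 / α := by positivity
  obtain ⟨C, hC, h⟩ := exists_abs_fwdDiff_iter_rpow_le k (H - 1 / α) (by linarith)
  exact ⟨C, hC, fun x hx ↦ by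
    rw [hKernel_eq_fwdDiff_iter α H k hx]
    exact h _ (by linarith)⟩

/-- `h_k(i) = O(i ^ (H - 1 / α - k))` along the positive integers. -/
lemma exists_abs_hKernel_natCast_le {α H : ℝ} {k : ℕ} (hα : 0 < α) (hH : H < 1) (hk : 1 ≤ k) :
    ∃ C, 0 < C ∧ ∀ i : ℕ, |hKernel α H k ((i : ℝ) + 1)| ≤
      C * ((i : ℝ) + 1) ^ (H - 1 / α - k) := by
  have hk' : (1 : ℝ) ≤ k := by exact_mod_cast hk
  have hα' : 0 < 1 / α := by positivity
  obtain ⟨C, hC, h⟩ := exists_abs_hKernel_le_sub_rpow hα hH hk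
  set e := H - 1 / α - k with he
  have he0 : e ≤ 0 := by linarith
  have hsum : ∀ i : ℕ, 0 ≤ |hKernel α H k ((i : ℝ) + 1)| / ((i : ℝ) + 1) ^ e :=
    fun i ↦ by positivity
  -- The finite sum covers `i < k`, where the decay estimate is unavailable. For `i ≥ k` one has `(i
  -- + 1) / (k + 1) ≤ i + 1 - k`. The final `1` makes the constant positive.
  refine ⟨∑ i ∈ Finset.range k, |hKernel α H k ((i : ℝ) + 1)| / ((i : ℝ) + 1) ^ e +
    C * ((k : ℝ) + 1) ^ (-e) + 1, by
      have := Finset.sum_nonneg fun i (_ : i ∈ Finset.range k) ↦ hsum i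
      positivity, fun i ↦ ?_⟩
  have hi : (0 : ℝ) < (i : ℝ) + 1 := by positivity
  rw [← div_le_iff₀ (Real.rpow_pos_of_pos hi e)]
  rcases lt_or_ge i k with hik | hik
  · have h1 := Finset.single_le_sum (fun j _ ↦ hsum j) (Finset.mem_range.2 hik)
    have h2 : 0 ≤ C * ((k : ℝ) + 1) ^ (-e) := by positivity
    linarith
  · have hik' : (k : ℝ) ≤ i := by exact_mod_cast hik
    have h1 : |hKernel α H k ((i : ℝ) + 1)| / ((i : ℝ) + 1) ^ e ≤ C * ((k : ℝ) + 1) ^ (-e) := by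
      rw [div_le_iff₀ (Real.rpow_pos_of_pos hi e)]
      refine (h _ (by linarith)).trans ?_
      rw [mul_assoc, Real.rpow_neg (by positivity), ← Real.inv_rpow (by positivity),
        ← Real.mul_rpow (by positivity) hi.le]
      refine mul_le_mul_of_nonneg_left (Real.rpow_le_rpow_of_nonpos (by positivity) ?_ he0) hC
      rw [inv_mul_le_iff₀ (by positivity)]
      nlinarith
    have := Finset.sum_nonneg fun i (_ : i ∈ Finset.range k) ↦ hsum i
    linarith

lemma measurable_posPow (a : ℝ) : Measurable (posPow a) :=
  Measurable.ite measurableSet_Ioi (by fun_prop) measurable_const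

lemma measurable_hKernel (α H : ℝ) (k : ℕ) : Measurable (hKernel α H k) := by
  unfold hKernel
  refine Finset.measurable_fun_sum _ fun j _ ↦ Measurable.const_mul ?_ _
  exact (measurable_posPow _).comp (by fun_prop)

lemma memLp_posPow_sub {a α : ℝ} (hα : 0 < α) (h : -1 < a * α) (c u : ℝ) :
    MemLp (fun x ↦ posPow a (x - c)) (ENNReal.ofReal α) (volume.restrict (Set.Ioc 0 u)) := by
  have hm : Measurable fun x ↦ posPow a (x - c) := (measurable_posPow a).comp (by fun_prop)
  rw [← integrable_norm_rpow_iff hm.aestronglyMeasurable (by simpa using hα) ENNReal.ofReal_ne_top,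
    ENNReal.toReal_ofReal hα.le]
  have h0 : IntegrableOn (fun x : ℝ ↦ x ^ (a * α)) (Set.Ioc 0 (max u c - c)) :=
    (intervalIntegrable_iff_integrableOn_Ioc_of_le (by simp)).1
      (intervalIntegral.intervalIntegrable_rpow' h)
  have h1 : Integrable ((Set.Ioc 0 (max u c - c)).indicator fun x : ℝ ↦ x ^ (a * α)) :=
    (integrable_indicator_iff measurableSet_Ioc).2 h0
  refine ((h1.comp_sub_right c).integrableOn (s := Set.Ioc 0 u)).congr_fun ?_ measurableSet_Ioc
  intro x hx
  have hxu : x - c ≤ max u c - c := by have := le_max_left u c; linarith [hx.2]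
  simp only [posPow, Set.indicator_apply, Set.mem_Ioc]
  by_cases hxc : 0 < x - c
  · rw [if_pos ⟨hxc, hxu⟩, if_pos hxc, Real.norm_of_nonneg (Real.rpow_nonneg hxc.le _),
      ← Real.rpow_mul hxc.le]
  · rw [if_neg fun h ↦ hxc h.1, if_neg hxc, norm_zero, Real.zero_rpow hα.ne']

lemma hKernel_of_nonpos (α H : ℝ) (k : ℕ) {x : ℝ} (hx : x ≤ 0) : hKernel α H k x = 0 := by
  refine Finset.sum_eq_zero fun j _ ↦ ?_
  have : (0 : ℝ) ≤ j := j.cast_nonneg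
  rw [posPow, if_neg (by linarith), mul_zero]

lemma hKernel_of_mem_Ioo (α H : ℝ) (k : ℕ) {x : ℝ} (hx : x ∈ Set.Ioo (0 : ℝ) 1) :
    hKernel α H k x = x ^ (H - 1 / α) := by
  rw [hKernel, Finset.sum_eq_single_of_mem 0 (by simp)]
  · simp [posPow, hx.1]
  · intro j _ hj
    have : (1 : ℝ) ≤ j := by exact_mod_cast Nat.one_le_iff_ne_zero.2 hj
    rw [posPow, if_neg (by linarith [hx.2]), mul_zero]

/-- The singularities at the integers `0, …, k` have order `αH - 1 > -1` after taking the `α`-th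
power, and at infinity the decay has exponent `-1 - α(k - H) < -1`. -/
theorem integrable_abs_hKernel_rpow {α H : ℝ} {k : ℕ} (hα : 0 < α) (hH : 0 < H) (hH' : H < 1)
    (hk : 1 ≤ k) : Integrable fun x : ℝ ↦ |hKernel α H k x| ^ α := by
  have hk' : (1 : ℝ) ≤ k := by exact_mod_cast hk
  have hm : Measurable fun x : ℝ ↦ |hKernel α H k x| ^ α :=
    (measurable_hKernel α H k).abs.pow_const α
  have hneg : IntegrableOn (fun x : ℝ ↦ |hKernel α H k x| ^ α) (Set.Iic 0) := by
    refine (integrableOn_zero (ε' := ℝ)).congr_fun (fun x hx ↦ ?_) measurableSet_Iic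
    simp [hKernel_of_nonpos α H k hx, Real.zero_rpow hα.ne']
  have hmid : IntegrableOn (fun x : ℝ ↦ |hKernel α H k x| ^ α) (Set.Ioc 0 (k + 1)) := by
    have hexp : -1 < (H - 1 / α) * α := by
      rw [sub_mul, one_div_mul_cancel hα.ne']
      nlinarith
    have : MemLp (hKernel α H k) (ENNReal.ofReal α) (volume.restrict (Set.Ioc 0 (k + 1))) :=
      memLp_finsetSum _ fun j _ ↦
        (memLp_posPow_sub hα hexp (j : ℝ) (k + 1)).const_mul _
    rw [← integrable_norm_rpow_iff (measurable_hKernel α H k).aestronglyMeasurable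
      (by simpa using hα) ENNReal.ofReal_ne_top, ENNReal.toReal_ofReal hα.le] at this
    exact this
  have htop : IntegrableOn (fun x : ℝ ↦ |hKernel α H k x| ^ α) (Set.Ioi (k + 1)) := by
    obtain ⟨C, hC, h⟩ := exists_abs_hKernel_le_sub_rpow hα hH' hk
    have hexp : (H - 1 / α - k) * α < -1 := by
      rw [sub_mul, sub_mul, one_div_mul_cancel hα.ne']
      nlinarith
    have h1 : IntegrableOn (fun x : ℝ ↦ C ^ α * (x - k) ^ ((H - 1 / α - k) * α))
        (Set.Ioi ((k : ℝ) + 1)) := by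
      refine Integrable.const_mul ?_ _
      have h2 : Integrable ((Set.Ioi (1 : ℝ)).indicator
          fun x : ℝ ↦ x ^ ((H - 1 / α - k) * α)) :=
        (integrable_indicator_iff measurableSet_Ioi).2
          (integrableOn_Ioi_rpow_of_lt hexp one_pos)
      refine ((h2.comp_sub_right (k : ℝ)).integrableOn).congr_fun (fun x hx ↦ ?_)
        measurableSet_Ioi
      have hx' : (k : ℝ) + 1 < x := hx
      exact Set.indicator_of_mem (Set.mem_Ioi.2 (by linarith)) _
    refine Integrable.mono' h1 hm.aestronglyMeasurable ?_
    filter_upwards [ae_restrict_mem measurableSet_Ioi] with x hx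
    have hx' : (k : ℝ) + 1 < x := hx
    have hxk : 0 < x - k := by linarith
    rw [Real.norm_of_nonneg (by positivity), Real.rpow_mul hxk.le,
      ← Real.mul_rpow hC (Real.rpow_nonneg hxk.le _)]
    exact Real.rpow_le_rpow (abs_nonneg _) (h x (by linarith)) hα.le
  have := (hneg.union hmid).union htop
  rw [Set.Iic_union_Ioc_eq_Iic (by positivity), Set.Iic_union_Ioi, integrableOn_univ] at this
  exact this

lemma hNorm_pos {α H : ℝ} {k : ℕ} (hα : 0 < α) (hH : 0 < H) (hH' : H < 1)
    (hk : 1 ≤ k) : 0 < hNorm α H k := by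
  refine Real.rpow_pos_of_pos ?_ _
  rw [integral_pos_iff_support_of_nonneg (fun x ↦ by positivity)
    (integrable_abs_hKernel_rpow hα hH hH' hk)]
  refine lt_of_lt_of_le (b := volume (Set.Ioo (0 : ℝ) 1)) (by simp) (measure_mono fun x hx ↦ ?_)
  rw [Function.mem_support, hKernel_of_mem_Ioo α H k hx]
  have := Real.rpow_pos_of_pos hx.1 (H - 1 / α)
  positivity

end Kernel

/-! ### The series `Φ̄_t`, uniformly in `t` -/

section Series

/-- The summand decreases, so the sum is at most the integral of `(1 + x/m)^(-q)` over `(0, ∞)`,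
which equals `m / (q - 1)`. -/
lemma sum_one_add_div_rpow_le {m q : ℝ} (hm : 0 < m) (hq : 1 < q) (n : ℕ) :
    ∑ i ∈ Finset.range n, (1 + ((i : ℝ) + 1) / m) ^ (-q) ≤ m / (q - 1) := by
  have hq' : 0 < q - 1 := by linarith
  have hpos : ∀ x : ℝ, 0 ≤ x → 0 < 1 + x / m := fun x hx ↦ by positivity
  have hanti : AntitoneOn (fun x : ℝ ↦ (1 + x / m) ^ (-q)) (Set.Icc 0 (0 + n)) := by
    intro x hx y _ hxy
    exact Real.rpow_le_rpow_of_nonpos (hpos x hx.1) (by gcongr) (by linarith)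
  have h := hanti.sum_le_integral
  simp only [zero_add, Nat.cast_add, Nat.cast_one] at h
  have hderiv : ∀ x ∈ Set.uIcc (0 : ℝ) n,
      HasDerivAt (fun x : ℝ ↦ -(m / (q - 1)) * (1 + x / m) ^ (1 - q)) ((1 + x / m) ^ (-q)) x := by
    intro x hx
    rw [Set.uIcc_of_le n.cast_nonneg] at hx
    have h1 : HasDerivAt (fun x : ℝ ↦ 1 + x / m) (1 / m) x :=
      ((hasDerivAt_id x).div_const m).const_add 1
    have h2 := (h1.rpow_const (p := 1 - q) (Or.inl (hpos x hx.1).ne')).const_mul (-(m / (q - 1)))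
    convert! h2 using 1
    rw [show 1 - q - 1 = -q by ring]
    field_simp
    ring
  have hcont : ContinuousOn (fun x : ℝ ↦ (1 + x / m) ^ (-q)) (Set.uIcc (0 : ℝ) n) := by
    rw [Set.uIcc_of_le n.cast_nonneg]
    exact ContinuousOn.rpow_const (by fun_prop) fun x hx ↦ Or.inl (hpos x hx.1).ne'
  rw [intervalIntegral.integral_eq_sub_of_hasDerivAt hderiv hcont.intervalIntegrable] at h
  have h3 : 0 ≤ m / (q - 1) * (1 + (n : ℝ) / m) ^ (1 - q) := by positivity
  simp only [zero_div, add_zero, Real.one_rpow, mul_one] at h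
  linarith

/-- The bound `2` for `ρ ≤ 1` and the quadratic bound for `ρ ≥ 1` are merged into one decreasing
function of `ρ`, suited to comparison with an integral. -/
lemma abs_cos_sub_one_le {γ ρ w : ℝ} (hγ : 0 < γ) (hρ : 0 < ρ) (hw : |w| ≤ ρ ^ (-γ)) :
    |Real.cos w - 1| ≤ 2 * 2 ^ (2 * γ) * (1 + ρ) ^ (-(2 * γ)) := by
  rw [Real.rpow_neg (by positivity), mul_assoc, ← Real.inv_rpow (by positivity),
    ← Real.mul_rpow (by positivity) (by positivity), abs_sub_comm,
    abs_of_nonneg (by linarith [Real.cos_le_one w])]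
  rcases le_total ρ 1 with h | h
  · have h1 : 1 ≤ (2 * (1 + ρ)⁻¹) ^ (2 * γ) := by
      refine Real.one_le_rpow ?_ (by positivity)
      rw [← div_eq_mul_inv, one_le_div (by positivity)]
      linarith
    linarith [Real.neg_one_le_cos w]
  · have h1 : w ^ 2 ≤ (2 * (1 + ρ)⁻¹) ^ (2 * γ) := by
      calc w ^ 2 = |w| ^ 2 := (sq_abs w).symm
        _ ≤ (ρ ^ (-γ)) ^ 2 := by gcongr
        _ = (ρ⁻¹) ^ (2 * γ) := by
          rw [← Real.rpow_two, ← Real.rpow_mul hρ.le, Real.inv_rpow hρ.le, ← Real.rpow_neg hρ.le]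
          congr 1
          ring
        _ ≤ _ := by
          refine Real.rpow_le_rpow (by positivity) ?_ (by positivity)
          rw [← div_eq_mul_inv, le_div_iff₀ (by positivity), inv_mul_le_iff₀ hρ]
          linarith
    have := Real.one_sub_sq_div_two_le_cos (x := w)
    nlinarith [sq_nonneg w]

lemma rpow_mul_exp_neg_le {c t p q : ℝ} (hc : 0 < c) (ht : 0 ≤ t) (hp : 0 ≤ p) (hpq : p ≤ q) :
    t ^ p * Real.exp (-(c * t ^ q)) ≤ 1 + 1 / c := by
  have htq : 0 ≤ t ^ q := Real.rpow_nonneg ht q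
  have h1 : t ^ p ≤ 1 + t ^ q := by
    rcases le_total t 1 with h | h
    · linarith [Real.rpow_le_one ht h hp]
    · linarith [Real.rpow_le_rpow_of_exponent_le h hpq]
  have h2 : Real.exp (-(c * t ^ q)) ≤ 1 := Real.exp_le_one_iff.2 (by simp; positivity)
  have h3 : t ^ q * Real.exp (-(c * t ^ q)) ≤ 1 / c := by
    rw [Real.exp_neg, ← div_eq_mul_inv, div_le_div_iff₀ (Real.exp_pos _) hc]
    linarith [Real.add_one_le_exp (c * t ^ q)]
  calc _ ≤ (1 + t ^ q) * Real.exp (-(c * t ^ q)) := by gcongr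
    _ ≤ _ := by linarith

/-- Absolute convergence of the series `Φ̄_t(x)` and the bound `|Φ̄_t(x)| ≤ K |x|^{α / β}`,
uniformly in `t`. -/
theorem exists_PhiBar_bound {σ α H : ℝ} {k : ℕ} (hσ : 0 < σ) (hα : 0 < α) (hα' : α < 2)
    (hH : 0 < H) (hH' : H < 1) (hk : 1 ≤ k) :
    ∃ K, 0 < K ∧ ∀ t : ℝ, 0 ≤ t → ∀ x : ℝ,
      (Summable fun i : ℕ ↦ Phi σ α H k t (hKernel α H k ((i : ℝ) + 1) * x)) ∧
      |PhiBar σ α H k t x| ≤ K * |x| ^ (k + 1 / α - H)⁻¹ := by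
  have hk' : (1 : ℝ) ≤ k := by exact_mod_cast hk
  have hα1 : 1 / 2 < 1 / α := one_div_lt_one_div_of_lt hα hα'
  obtain ⟨C, hC, hker⟩ := exists_abs_hKernel_natCast_le (H := H) hα hH' hk
  rw [show H - 1 / α - (k : ℝ) = -(k + 1 / α - H) by ring] at hker
  set γ := k + 1 / α - H with hγdef
  have hγ : 0 < γ := by linarith
  have hγ2 : 1 < 2 * γ := by linarith
  -- Equivalent to `H ≤ k`; it lets the exponential damping absorb `t ^ γ⁻¹`.
  have hγα : γ⁻¹ ≤ α := by
    refine inv_le_of_inv_le₀ hα ?_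
    rw [inv_eq_one_div]
    linarith
  have hN := hNorm_pos hα hH hH' hk
  set c := (σ * hNorm α H k) ^ α with hc
  have hc0 : 0 < c := by positivity
  set D : ℝ := 2 * 2 ^ (2 * γ) with hD
  have hD0 : 0 < D := by positivity
  have hγ2' : 0 < 2 * γ - 1 := by linarith
  refine ⟨D / (2 * γ - 1) * C ^ γ⁻¹ * (1 + 1 / c), by positivity, fun t ht x ↦ ?_⟩
  set f : ℕ → ℝ := fun i ↦ Phi σ α H k t (hKernel α H k ((i : ℝ) + 1) * x) with hf
  suffices hsum : ∀ n, ∑ i ∈ Finset.range n, |f i| ≤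
      D / (2 * γ - 1) * C ^ γ⁻¹ * (1 + 1 / c) * |x| ^ γ⁻¹ by
    have hs : Summable fun i ↦ |f i| := summable_of_sum_range_le (fun i ↦ abs_nonneg _) hsum
    refine ⟨hs.of_abs, ?_⟩
    have h1 : |∑' i, f i| ≤ ∑' i, |f i| := by
      simpa [Real.norm_eq_abs] using norm_tsum_le_tsum_norm (f := f) (by simpa using hs)
    exact h1.trans (hs.tsum_le_of_sum_range_le hsum)
  intro n
  -- The degenerate case is split off because the scale `m` below would vanish.
  rcases eq_or_ne (t * x) 0 with h0 | h0
  · have hz : ∀ i, f i = 0 := fun i ↦ by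
      simp only [hf, Phi]
      rw [show t * (hKernel α H k ((i : ℝ) + 1) * x) = hKernel α H k ((i : ℝ) + 1) * (t * x) by
        ring, h0]
      simp
    simp only [hz, abs_zero, Finset.sum_const_zero]
    positivity
  have ht0 : 0 < t := ht.lt_of_ne' (left_ne_zero_of_mul h0)
  have hx0 : 0 < |x| := abs_pos.2 (right_ne_zero_of_mul h0)
  -- The index at which the bound `C t |x| i^(-γ)` on the cosine's argument drops to one.
  set m := (C * t * |x|) ^ γ⁻¹ with hm
  have hm0 : 0 < m := by positivity
  set E := Real.exp (-|σ * hNorm α H k * t| ^ α) with hE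
  have hterm : ∀ i, |f i| ≤ D * E * (1 + ((i : ℝ) + 1) / m) ^ (-(2 * γ)) := fun i ↦ by
    have hi : (0 : ℝ) < (i : ℝ) + 1 := by positivity
    have hw : |t * (hKernel α H k ((i : ℝ) + 1) * x)| ≤ (((i : ℝ) + 1) / m) ^ (-γ) := by
      rw [Real.div_rpow hi.le hm0.le, hm, ← Real.rpow_mul (by positivity), mul_neg,
        inv_mul_cancel₀ hγ.ne', Real.rpow_neg_one, div_inv_eq_mul, abs_mul, abs_mul,
        abs_of_pos ht0]
      calc t * (|hKernel α H k ((i : ℝ) + 1)| * |x|)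
          ≤ t * (C * ((i : ℝ) + 1) ^ (-γ) * |x|) := by gcongr; exact hker i
        _ = _ := by ring
    have := abs_cos_sub_one_le hγ (by positivity) hw
    simp only [hf, Phi]
    rw [abs_mul, abs_of_pos (Real.exp_pos _)]
    calc _ ≤ D * (1 + ((i : ℝ) + 1) / m) ^ (-(2 * γ)) * E := by gcongr
      _ = _ := by ring
  have hEt : t ^ γ⁻¹ * E ≤ 1 + 1 / c := by
    rw [hE, abs_of_pos (by positivity), Real.mul_rpow (by positivity) ht]
    exact rpow_mul_exp_neg_le hc0 ht (by positivity) hγα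
  calc ∑ i ∈ Finset.range n, |f i|
      ≤ ∑ i ∈ Finset.range n, D * E * (1 + ((i : ℝ) + 1) / m) ^ (-(2 * γ)) :=
        Finset.sum_le_sum fun i _ ↦ hterm i
    _ ≤ D * E * (m / (2 * γ - 1)) := by
        rw [← Finset.mul_sum]
        have := sum_one_add_div_rpow_le hm0 hγ2 n
        gcongr
    _ = D / (2 * γ - 1) * C ^ γ⁻¹ * (t ^ γ⁻¹ * E) * |x| ^ γ⁻¹ := by
        rw [hm, Real.mul_rpow (by positivity) (abs_nonneg x), Real.mul_rpow hC.le ht]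
        ring
    _ ≤ _ := by gcongr

lemma measurable_PhiBar {σ α H : ℝ} {k : ℕ} {t : ℝ}
    (hs : ∀ x : ℝ, Summable fun i : ℕ ↦ Phi σ α H k t (hKernel α H k ((i : ℝ) + 1) * x)) :
    Measurable (PhiBar σ α H k t) := by
  refine measurable_of_tendsto_metrizable (f := fun (n : ℕ) (x : ℝ) ↦
    ∑ i ∈ Finset.range n, Phi σ α H k t (hKernel α H k ((i : ℝ) + 1) * x)) (fun n ↦ ?_)
    (tendsto_pi_nhds.2 fun x ↦ (hs x).hasSum.tendsto_sum_nat)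
  unfold Phi
  fun_prop

end Series

/-! ### Tails and independence of the stable increments -/

section Stable

/-- The tail at `y` is controlled by the mean of `1 - charFun` over `|u| ≤ 2/y`, where `1 -
exp(-|σu|^α) ≤ |σu|^α`. -/
lemma measureReal_abs_gt_le_of_charFun {μ : Measure ℝ} [IsProbabilityMeasure μ] {α σ : ℝ}
    (hα : 0 < α) (hchar : ∀ u, charFun μ u = Complex.exp (-((|σ * u| ^ α : ℝ) : ℂ)))
    {y : ℝ} (hy : 0 < y) :
    μ.real {x | y < |x|} ≤ 2 * (2 * |σ|) ^ α * y ^ (-α) := by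
  have hbound : ∀ u ∈ Set.uIoc (-2 * y⁻¹) (2 * y⁻¹), ‖1 - charFun μ u‖ ≤
      (2 * |σ|) ^ α * y ^ (-α) := fun u hu ↦ by
    rw [Set.uIoc_of_le (by have := inv_pos.2 hy; linarith)] at hu
    have hu' : |u| ≤ 2 * y⁻¹ := abs_le.2 ⟨by linarith [hu.1], hu.2⟩
    rw [hchar, ← Complex.ofReal_neg, ← Complex.ofReal_exp, ← Complex.ofReal_one,
      ← Complex.ofReal_sub, Complex.norm_real, Real.norm_of_nonneg
        (sub_nonneg.2 (Real.exp_le_one_iff.2 (by simp; positivity)))]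
    calc 1 - Real.exp (-|σ * u| ^ α) ≤ |σ * u| ^ α := by
          linarith [Real.add_one_le_exp (-|σ * u| ^ α)]
      _ ≤ (2 * |σ| * y⁻¹) ^ α := by
          rw [abs_mul]
          refine Real.rpow_le_rpow (by positivity) ?_ hα.le
          nlinarith [abs_nonneg σ]
      _ = _ := by
          rw [Real.mul_rpow (by positivity) (by positivity), Real.rpow_neg hy.le,
            Real.inv_rpow hy.le]
  refine (measureReal_abs_gt_le_integral_charFun hy).trans ?_
  have h := intervalIntegral.norm_integral_le_of_norm_le_const hbound
  have hy' : |2 * y⁻¹ - -2 * y⁻¹| = 4 * y⁻¹ := by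
    rw [show 2 * y⁻¹ - -2 * y⁻¹ = 4 * y⁻¹ by ring, abs_of_pos (by positivity)]
  rw [hy'] at h
  calc _ ≤ 2⁻¹ * y * ((2 * |σ|) ^ α * y ^ (-α) * (4 * y⁻¹)) := by gcongr
    _ = _ := by field_simp; ring

variable {Ω : Type*} [MeasurableSpace Ω] {P : Measure Ω}

lemma IsSymmetricStableLevyProcess.map_increment {α σ : ℝ} {L : ℝ → Ω → ℝ}
    (hL : IsSymmetricStableLevyProcess α σ L P) (s : ℝ) :
    P.map (fun ω ↦ L (s + 1) ω - L s ω) = P.map (L 1) := by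
  rw [(hL.isLevyProcess.stationary_increments s (s + 1) (by linarith)).map_eq, add_sub_cancel_left]
  refine Measure.map_congr ?_
  filter_upwards [hL.isLevyProcess.zero] with ω hω
  rw [hω, sub_zero]

lemma IsSymmetricStableLevyProcess.measureReal_abs_increment_gt_le [IsProbabilityMeasure P]
    {α σ : ℝ} (hα : 0 < α) {L : ℝ → Ω → ℝ}
    (hL : IsSymmetricStableLevyProcess α σ L P) (s : ℝ) {y : ℝ} (hy : 0 < y) :
    P.real {ω | y < |L (s + 1) ω - L s ω|} ≤ 2 * (2 * |σ|) ^ α * y ^ (-α) := by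
  have hm : Measurable fun ω ↦ L (s + 1) ω - L s ω :=
    (hL.isLevyProcess.measurable _).sub (hL.isLevyProcess.measurable _)
  have := Measure.isProbabilityMeasure_map (μ := P) hm.aemeasurable
  have h := measureReal_abs_gt_le_of_charFun (μ := P.map fun ω ↦ L (s + 1) ω - L s ω) hα
    (fun u ↦ by rw [hL.map_increment s]; exact hL.charFun_one u) hy
  rwa [map_measureReal_apply hm (measurableSet_lt measurable_const (by fun_prop))] at h

lemma iIndepFun_PhiBar_increment {σ α H : ℝ} {k : ℕ} {t : ℝ} {L : ℝ → Ω → ℝ}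
    (hL : IsLevyProcess L P) (hm : Measurable (PhiBar σ α H k t)) :
    iIndepFun (fun (i : ℕ) ω ↦ PhiBar σ α H k t (L ((i : ℝ) + 1) ω - L (i : ℝ) ω)) P := by
  have h := (hL.indep_increments.nat (t := fun i : ℕ ↦ (i : ℝ)) Nat.mono_cast).comp
    (fun _ ↦ PhiBar σ α H k t) fun _ ↦ hm
  simpa only [Function.comp_def, Nat.cast_add, Nat.cast_one] using h

end Stable

/-! ### Uniform tails of `Φ̄_t` of the increments and of `S̄_n(t)` -/

section Moments

variable {Ω : Type*} [MeasurableSpace Ω] {P : Measure Ω} [IsProbabilityMeasure P]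

/-- The variables `Φ̄_t(L_{i+1} - L_i)` have power tails of order `β`, uniformly in `t` and `i`. -/
lemma exists_PhiBar_increment_tail {σ α H : ℝ} {k : ℕ} (hσ : 0 < σ) (hα : 0 < α) (hα' : α < 2)
    (hH : 0 < H) (hH' : H < 1) (hk : 1 ≤ k) {L : ℝ → Ω → ℝ}
    (hL : IsSymmetricStableLevyProcess α σ L P) :
    ∃ C, 0 ≤ C ∧ ∀ t : ℝ, 0 ≤ t → ∀ (i : ℕ) (y : ℝ), 0 < y →
      P.real {ω | y < |PhiBar σ α H k t (L ((i : ℝ) + 1) ω - L (i : ℝ) ω)|} ≤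
        C * y ^ (-betaIndex α H k) := by
  have hk' : (1 : ℝ) ≤ k := by exact_mod_cast hk
  have hα1 : 0 < 1 / α := by positivity
  obtain ⟨K, hK, h⟩ := exists_PhiBar_bound hσ hα hα' hH hH' hk
  set γ := k + 1 / α - H with hγdef
  have hγ : 0 < γ := by linarith
  have hβ : γ * -α = -betaIndex α H k := by
    rw [hγdef, betaIndex]
    field_simp
    ring
  refine ⟨2 * (2 * |σ|) ^ α * (K⁻¹) ^ (-betaIndex α H k), by positivity, fun t ht i y hy ↦ ?_⟩
  -- By the pointwise bound, `|Φ̄_t| > y` forces the increment above `(y/K)^γ`, and `γα = β`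
  -- converts the exponent.
  have hyK : 0 < y * K⁻¹ := by positivity
  refine (measureReal_mono fun ω hω ↦ ?_).trans
    ((hL.measureReal_abs_increment_gt_le hα i (Real.rpow_pos_of_pos hyK γ)).trans (le_of_eq ?_))
  · simp only [Set.mem_ofPred_eq] at hω ⊢
    rw [← Real.lt_rpow_inv_iff_of_pos hyK.le (abs_nonneg _) hγ, ← div_eq_mul_inv,
      div_lt_iff₀' hK]
    exact hω.trans_le (h t ht _).2
  · rw [← Real.rpow_mul hyK.le, hβ, Real.mul_rpow hy.le (by positivity)]
    ring

/-- The sum bound at level `y n^(1/β)` carries the factor `n · n^(-1) = 1`, so the constant does not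
depend on `n`. -/
lemma exists_SBar_tail {σ α H : ℝ} {k : ℕ} (hσ : 0 < σ) (hα : 0 < α) (hα' : α < 2)
    (hH : 0 < H) (hH' : H < 1) (hk : 1 ≤ k) (hstable : (k : ℝ) < H + 1 / α) {L : ℝ → Ω → ℝ}
    (hL : IsSymmetricStableLevyProcess α σ L P) :
    ∃ C, 0 ≤ C ∧ ∀ (n : ℕ) (t : ℝ), 0 ≤ t → ∀ y : ℝ, 0 < y →
      P.real {ω | y < |SBar σ α H k L P n t ω|} ≤ C * y ^ (-betaIndex α H k) := by
  have hk' : (1 : ℝ) ≤ k := by exact_mod_cast hk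
  obtain ⟨K, -, h⟩ := exists_PhiBar_bound hσ hα hα' hH hH' hk
  obtain ⟨C, hC, htail⟩ := exists_PhiBar_increment_tail hσ hα hα' hH hH' hk hL
  set β := betaIndex α H k with hβdef
  have hβ1 : 1 < β := by
    have : 0 < α * (k - H) := mul_pos hα (by linarith)
    rw [hβdef, betaIndex]
    linarith
  have hβ2 : β < 2 := by
    have : α * (k - H) < α * (1 / α) := mul_lt_mul_of_pos_left (by linarith) hα
    rw [mul_one_div_cancel hα.ne'] at this
    rw [hβdef, betaIndex]
    linarith
  have hβ1' : 0 < β - 1 := by linarith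
  have hβ2' : 0 < 2 - β := by linarith
  set M := C + 2 * (C * β / (β - 1)) + 4 * (C * 2 / (2 - β)) with hM
  have hM0 : 0 ≤ M := by positivity
  refine ⟨M, hM0, fun n t ht y hy ↦ ?_⟩
  have hyβ : 0 ≤ M * y ^ (-β) := by positivity
  rcases n.eq_zero_or_pos with rfl | hn
  · have hz : ∀ ω, SBar σ α H k L P 0 t ω = 0 := fun ω ↦ by
      rw [SBar, Finset.Icc_eq_empty (by omega), Finset.sum_empty, mul_zero]
    simpa [hz, hy.not_gt] using hyβ
  have hn' : (0 : ℝ) < n := by exact_mod_cast hn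
  have hm := measurable_PhiBar fun x ↦ (h t ht x).1
  have hv : 0 < y * (n : ℝ) ^ (1 / β) := by positivity
  have key := measureReal_abs_sum_sub_integral_gt_le
    (fun i : ℕ ↦ hm.comp ((hL.isLevyProcess.measurable ((i : ℝ) + 1)).sub
      (hL.isLevyProcess.measurable i)))
    (iIndepFun_PhiBar_increment hL.isLevyProcess hm) hC hβ1 hβ2 (htail t ht) (Finset.Icc k n) hv
  rw [← hM] at key
  calc P.real {ω | y < |SBar σ α H k L P n t ω|}
      = P.real {ω | y * (n : ℝ) ^ (1 / β) < |∑ i ∈ Finset.Icc k n,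
          (PhiBar σ α H k t (L ((i : ℝ) + 1) ω - L (i : ℝ) ω)
            - ∫ ω', PhiBar σ α H k t (L ((i : ℝ) + 1) ω' - L (i : ℝ) ω') ∂P)|} := by
        congr 1 with ω
        rw [Set.mem_ofPred_eq, Set.mem_ofPred_eq, SBar, abs_mul, ← hβdef, neg_div,
          Real.rpow_neg hn'.le, abs_of_pos (by positivity), lt_inv_mul_iff₀ (by positivity),
          mul_comm]
    _ ≤ M * (Finset.Icc k n).card * (y * (n : ℝ) ^ (1 / β)) ^ (-β) := key
    _ ≤ M * n * (y * (n : ℝ) ^ (1 / β)) ^ (-β) := by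
        -- The range has `n + 1 - k` terms (none if `k > n`), and `k ≥ 1`.
        have : (Finset.Icc k n).card ≤ n := by rw [Nat.card_Icc]; omega
        gcongr
    _ = M * y ^ (-β) := by
        rw [Real.mul_rpow hy.le (by positivity), ← Real.rpow_mul hn'.le, mul_neg,
          one_div_mul_cancel (by linarith), Real.rpow_neg_one]
        field_simp

end Moments

end StableRegime

theorem mainTheorem4 {Ω : Type*} [MeasurableSpace Ω] (P : Measure Ω) [IsProbabilityMeasure P]
    (σ α H : ℝ) (k : ℕ) (hσ : 0 < σ) (hα : 0 < α) (hα' : α < 2) (hH : 0 < H) (hH' : H < 1)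
    (hk : 1 ≤ k) (hstable : (k : ℝ) < H + 1 / α)
    (L : ℝ → Ω → ℝ) (hL : StableRegime.IsSymmetricStableLevyProcess α σ L P) :
    -- the quantities that define `S̄_n(t)` exist
    Integrable (fun x : ℝ ↦ |StableRegime.hKernel α H k x| ^ α) ∧
    (∀ t : ℝ, 0 ≤ t → ∀ x : ℝ, Summable fun i : ℕ ↦
      StableRegime.Phi σ α H k t (StableRegime.hKernel α H k ((i : ℝ) + 1) * x)) ∧
    (∀ t : ℝ, 0 ≤ t → ∀ i : ℕ, Integrable
      (fun ω ↦ StableRegime.PhiBar σ α H k t (L ((i : ℝ) + 1) ω - L (i : ℝ) ω)) P) ∧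
    -- the uniform moment bound
    ∀ r : ℝ, 0 < r → r < StableRegime.betaIndex α H k →
      (⨆ (n : ℕ) (t : ℝ) (_ : 0 ≤ t),
        ∫⁻ ω, ENNReal.ofReal (|StableRegime.SBar σ α H k L P n t ω| ^ r) ∂P) < ∞ := by
  have hk' : (1 : ℝ) ≤ k := by exact_mod_cast hk
  have hβ1 : 1 < StableRegime.betaIndex α H k := by
    have : 0 < α * (k - H) := mul_pos hα (by linarith)
    rw [StableRegime.betaIndex]
    linarith
  obtain ⟨K, -, hPhi⟩ := StableRegime.exists_PhiBar_bound hσ hα hα' hH hH' hk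
  have hm : ∀ t : ℝ, 0 ≤ t → Measurable (StableRegime.PhiBar σ α H k t) := fun t ht ↦
    StableRegime.measurable_PhiBar fun x ↦ (hPhi t ht x).1
  have hmi : ∀ t : ℝ, 0 ≤ t → ∀ i : ℕ, Measurable
      fun ω ↦ StableRegime.PhiBar σ α H k t (L ((i : ℝ) + 1) ω - L (i : ℝ) ω) := fun t ht i ↦
    (hm t ht).comp ((hL.isLevyProcess.measurable _).sub (hL.isLevyProcess.measurable _))
  refine ⟨StableRegime.integrable_abs_hKernel_rpow hα hH hH' hk, fun t ht x ↦ (hPhi t ht x).1,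
    fun t ht i ↦ ?_, fun r hr hrβ ↦ ?_⟩
  · obtain ⟨C, hC, htail⟩ := StableRegime.exists_PhiBar_increment_tail hσ hα hα' hH hH' hk hL
    exact StableRegime.integrable_of_tail (hmi t ht i) hC hβ1 (htail t ht i)
  · obtain ⟨C, hC, htail⟩ := StableRegime.exists_SBar_tail hσ hα hα' hH hH' hk hstable hL
    refine lt_of_le_of_lt (iSup_le fun n ↦ iSup_le fun t ↦ iSup_le fun ht ↦
      StableRegime.lintegral_abs_rpow_le_of_tail
        (Measurable.const_mul (Finset.measurable_fun_sum _ fun i _ ↦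
          (hmi t ht i).sub_const _) _) hC hr hrβ (htail n t ht)) ?_
    exact ENNReal.add_lt_top.2 ⟨ENNReal.one_lt_top, ENNReal.ofReal_lt_top⟩
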